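/- Let $G=(V,E)$ be a finite simple graph with edge weights $w\in\mathbb R^E$. A matching is a set of edges no two of which share a node; it is \emph{cardinality-optimal} if its weight is minimum among all matchings of $G$ with the same cardinality. For $U\subseteq V$ let $E[U]$ be the set of edges inside $U$ and $\delta(U)$ the set of edges with exactly one end in $U$. \textbf{The algorithm} (Edmonds' minimum-weight perfect matching algorithm in Schrijver's version, with arbitrary choices among the possible steps). A state consists of: a collection $\Omega$ of odd subsets of $V$; for each $U\in\Omega$ with $|U|\ge 3$ the edge set of an odd circuit $C_U$ (the circuit whose shrinking created $U$); dual values $\pi(U)$; and an edge set $\widetilde M\subseteq E$. The dual values are \emph{feasible} if $\pi(U)\ge 0$ for all odd $U$ with $|U|\ge 3$, and $\sum_{U:\,e\in\delta(U)}\pi(U)\le w_e$ for all $e\in E$ (sum over odd $U$). The graph $G'$ has as nodes the inclusion-wise maximal sets in $\Omega$ and as edges the edges of $G$ that join two different such sets and satisfy the last inequality with equality. The current matching $M$ of $G'$ consists of the edges of $\widetilde M$ that join different nodes of $G'$, and $X$ is the set of nodes of $G'$ not covered by $M$. Initially $\Omega$ consists of all singletons, $\widetilde M=\emptyset$, $\pi$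 is feasible, and $\pi(U)=0$ for $U\notin\Omega$. The steps are: \begin{itemize} \item \emph{Augmentation.} If $P$ is an $M$-alternating path in $G'$ joining two different nodes in $X$, then $M$ is replaced by $M\,\Delta\,P$, and $\widetilde M$ by the matching obtained from it by iterated deshrinking: for every $U\in\Omega$ with $|U|\ge3$ there is a vertex $B$ of $C_U$ (the one covered from outside $U$, if there is such a vertex) such that a perfect matching of $C_U-B$ is used. Inside nodes of $G'$ not on $P$, $\widetilde M$ does not change. \item \emph{Shrinking.} If $N_0,\dots,N_t$ is an $M$-alternating walk in $G'$ with $N_0\in X$, $N_0,\dots,N_{t-1}$ distinct and $N_t=N_i$, where $i<t$ is even and $t$ is odd, then $U=N_i\cup\dots\cup N_{t-1}$ is added to $\Omega$ with the circuit $C_U$ traversed by the walk from $N_i$ to $N_t$, and with $\pi(U)=0$. The matching $\widetilde M$ does not change. \item \emph{Dual update.} Suppose that $G'$ has no $M$-alternating walk of positive length from $X$ to $X$. Let $\mathcal S$ (resp. $\mathcal T$) be the set of nodes of $G'$ reached from $X$ by an $M$-alternating walk of odd (resp. even, possibly zero) length. For some positive rates $d(U)$, $U\in\mathcal S\cup\mathcal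 T$, that agree at the two ends of each edge of $M$ (in the standard version $d\equiv1$), $\pi(U)$ is increased by $\alpha d(U)$ for $U\in\mathcal T$ and decreased by $\alpha d(U)$ for $U\in\mathcal S$, where $\alpha\ge 0$ is the largest number for which $\pi$ stays feasible (if there is no largest number, the algorithm stops). Then all $U\in\mathcal S$ with $|U|\ge 3$ and now $\pi(U)=0$ are removed from $\Omega$. The matching $\widetilde M$ does not change. \end{itemize} \textbf{Theorem.} Consider a run of the algorithm such that (a) initially $\pi(U)=0$ for all $U$ with $|U|\geq 3$ and there is $\beta\in\mathbb R$ with $\pi(\{v\})=\beta$ for all $v\in V$, and (b) in every dual update the values $\pi(U)$, $U\in\mathcal T$, are all increased by the same amount. Then at every stage of the run $\widetilde M$ is a cardinality-optimal matching of $G$. -/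

import Mathlib

/-! ### Matchings -/

/-- A matching of `G`: a set of edges, no two of which share a node. -/
def IsEdgeMatching {V : Type*} (G : SimpleGraph V) (M : Finset (Sym2 V)) : Prop :=
  (∀ e ∈ M, e ∈ G.edgeSet) ∧ ∀ e ∈ M, ∀ f ∈ M, ∀ v, v ∈ e → v ∈ f → e = f

/-- A matching of minimum weight among all matchings of the same cardinality. -/
def CardinalityOptimal {V : Type*} (G : SimpleGraph V) (w : Sym2 V → ℝ)
    (M : Finset (Sym2 V)) : Prop :=
  IsEdgeMatching G M ∧
    ∀ M' : Finset (Sym2 V), IsEdgeMatching G M' → M'.card = M.card →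
      ∑ e ∈ M, w e ≤ ∑ e ∈ M', w e

/-- `e ∈ E[U]`: both ends of `e` lie in `U`. -/
def EdgeWithin {V : Type*} (e : Sym2 V) (U : Finset V) : Prop := ∀ v ∈ e, v ∈ U

/-- `e ∈ δ(U)`: exactly one end of `e` lies in `U`. -/
def EdgeCuts {V : Type*} (e : Sym2 V) (U : Finset V) : Prop :=
  (∃ v ∈ e, v ∈ U) ∧ ∃ v ∈ e, v ∉ U

/-! ### Dual solutions -/

open Classical in
/-- The left-hand side of the edge constraint: the sum of `π U` over all odd sets `U` with
`e ∈ δ(U)`. -/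
noncomputable def cutSum {V : Type*} [Fintype V] (π : Finset V → ℝ) (e : Sym2 V) : ℝ :=
  ∑ U ∈ (Finset.univ : Finset (Finset V)) with Odd U.card ∧ EdgeCuts e U, π U

/-- The dual constraints on `π`. -/
def DualFeasible {V : Type*} [Fintype V] (G : SimpleGraph V) (w : Sym2 V → ℝ)
    (π : Finset V → ℝ) : Prop :=
  (∀ U : Finset V, Odd U.card → 3 ≤ U.card → 0 ≤ π U) ∧
    ∀ e ∈ G.edgeSet, cutSum π e ≤ w e

/-! ### States of the algorithm -/

/-- The inclusion-wise maximal members of `Ω`; these are the nodes of the shrunken graph `G'`. -/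
def maxSets {V : Type*} (Ω : Finset (Finset V)) : Set (Finset V) :=
  {A | A ∈ Ω ∧ ∀ B ∈ Ω, A ⊆ B → B = A}

/-- The inclusion-wise maximal members of `Ω` that are properly contained in `U`. -/
def childSets {V : Type*} (Ω : Finset (Finset V)) (U : Finset V) : Set (Finset V) :=
  {A | A ∈ Ω ∧ A ⊂ U ∧ ∀ B ∈ Ω, B ⊂ U → A ⊆ B → B = A}

/-- A state of the algorithm: the collection `Ω`, for every shrunken set `U ∈ Ω` the edge set
`cyc U` of the odd circuit `C_U` whose shrinking created `U`, the dual values, and the matching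
of `G` that is obtained by deshrinking the current matching of `G'` (the matching `M̃`). -/
structure EdmondsState (V : Type*) where
  Ω : Finset (Finset V)
  cyc : Finset V → Finset (Sym2 V)
  dual : Finset V → ℝ
  matching : Finset (Sym2 V)

namespace EdmondsState

variable {V : Type*}

/-- The current matching `M` of `G'`: the edges of `M̃` that survive the shrinking, i.e. those
whose ends lie in different nodes of `G'`. -/
def shrunkMatching (s : EdmondsState V) : Set (Sym2 V) :=
  {e | e ∈ s.matching ∧ ∀ A ∈ maxSets s.Ω, ¬ EdgeWithin e A}

/-- `X`: the nodes of `G'` that are not covered by `M`. -/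
def exposedNodes (s : EdmondsState V) : Set (Finset V) :=
  {A | A ∈ maxSets s.Ω ∧ ∀ e ∈ s.shrunkMatching, ¬ EdgeCuts e A}

/-- The edges of `M̃` inside `U` that join different members of `childSets Ω U`. -/
def levelEdges (s : EdmondsState V) (U : Finset V) : Set (Sym2 V) :=
  {e | e ∈ s.matching ∧ EdgeWithin e U ∧ ∀ A ∈ childSets s.Ω U, ¬ EdgeWithin e A}

/-- `M̃` arises from `M` by iterated deshrinking: for every shrunken set `U` there is a vertex
`B` of the circuit `C_U` that contains the end in `U` of every edge of `M̃` leaving `U`, and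
inside `U` the matching consists, at the level of `C_U`, of a perfect matching of `C_U - B`. -/
def Expanded (s : EdmondsState V) : Prop :=
  ∀ U ∈ s.Ω, 3 ≤ U.card → ∃ B ∈ childSets s.Ω U,
    (∀ e ∈ s.matching, EdgeCuts e U → ∃ v ∈ e, v ∈ B) ∧
    (∀ e ∈ s.levelEdges U, e ∈ s.cyc U ∧ ¬ EdgeCuts e B) ∧
    ∀ A ∈ childSets s.Ω U, A ≠ B → ∃! e, e ∈ s.levelEdges U ∧ EdgeCuts e A

variable [Fintype V]

/-- `e` is an edge of `G'` joining the nodes `A` and `B`: an edge of `G` between `A` and `B`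
whose dual constraint is tight. -/
def Joins (G : SimpleGraph V) (w : Sym2 V → ℝ) (s : EdmondsState V)
    (e : Sym2 V) (A B : Finset V) : Prop :=
  A ∈ maxSets s.Ω ∧ B ∈ maxSets s.Ω ∧ A ≠ B ∧ e ∈ G.edgeSet ∧ cutSum s.dual e = w e ∧
    ∃ u ∈ A, ∃ v ∈ B, e = s(u, v)

/-- `N 0, e 0, N 1, …, e (n - 1), N n` is an `M`-alternating walk of length `n` in `G'`.
Values of `N` beyond `n` and of `e` beyond `n - 1` are irrelevant. -/
structure IsAltWalk (G : SimpleGraph V) (w : Sym2 V → ℝ) (s : EdmondsState V)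
    (n : ℕ) (N : ℕ → Finset V) (e : ℕ → Sym2 V) : Prop where
  node : ∀ i ≤ n, N i ∈ maxSets s.Ω
  edge : ∀ i < n, s.Joins G w (e i) (N i) (N (i + 1))
  alt : ∀ i, i + 1 < n → (e i ∈ s.shrunkMatching ↔ e (i + 1) ∉ s.shrunkMatching)

/-- `𝒮`: the nodes of `G'` that are reached from `X` by an `M`-alternating walk of odd length. -/
def oddNodes (G : SimpleGraph V) (w : Sym2 V → ℝ) (s : EdmondsState V) : Set (Finset V) :=
  {A | ∃ n N e, s.IsAltWalk G w n N e ∧ Odd n ∧ N 0 ∈ s.exposedNodes ∧ N n = A}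

/-- `𝒯`: the nodes of `G'` that are reached from `X` by an `M`-alternating walk of even length
(possibly zero). -/
def evenNodes (G : SimpleGraph V) (w : Sym2 V → ℝ) (s : EdmondsState V) : Set (Finset V) :=
  {A | ∃ n N e, s.IsAltWalk G w n N e ∧ Even n ∧ N 0 ∈ s.exposedNodes ∧ N n = A}

/-- `G'` has an `M`-alternating walk of positive length from `X` to `X`. -/
def HasExposedWalk (G : SimpleGraph V) (w : Sym2 V → ℝ) (s : EdmondsState V) : Prop :=
  ∃ n N e, s.IsAltWalk G w n N e ∧ 0 < n ∧ N 0 ∈ s.exposedNodes ∧ N n ∈ s.exposedNodes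

/-! ### The steps of the algorithm -/

/-- Initial states: `Ω` consists of the singletons, the matching is empty, and the dual values
are zero outside `Ω` and satisfy the dual constraints. -/
structure IsStart (G : SimpleGraph V) (w : Sym2 V → ℝ) (s : EdmondsState V) : Prop where
  omega : ∀ U, U ∈ s.Ω ↔ ∃ v, U = {v}
  cyc : ∀ U, s.cyc U = ∅
  matching : s.matching = ∅
  support : ∀ U, U ∉ s.Ω → s.dual U = 0
  feasible : DualFeasible G w s.dual

/-- Augmentation along an `M`-alternating path `P` of `G'` between two nodes in `X`. The new
matching `M` is `M ∆ P`, and the new `M̃` is obtained from it by deshrinking, where nothing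
changes inside the nodes of `G'` that are not on `P`. -/
def Augment (G : SimpleGraph V) (w : Sym2 V → ℝ) (s s' : EdmondsState V) : Prop :=
  ∃ n N e, s.IsAltWalk G w n N e ∧ 0 < n ∧ Set.InjOn N (Set.Iic n) ∧
    N 0 ∈ s.exposedNodes ∧ N n ∈ s.exposedNodes ∧
    s'.Ω = s.Ω ∧ s'.cyc = s.cyc ∧ s'.dual = s.dual ∧
    s'.shrunkMatching = symmDiff s.shrunkMatching (e '' Set.Iio n) ∧
    (∀ f ∈ s'.matching, f ∈ G.edgeSet) ∧ s'.Expanded ∧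
    ∀ A ∈ maxSets s.Ω, (∀ i ≤ n, N i ≠ A) →
      ∀ f, EdgeWithin f A → (f ∈ s'.matching ↔ f ∈ s.matching)

/-- Shrinking: an `M`-alternating walk from `X` whose nodes `N 0, …, N (t - 1)` are distinct
and that closes up at `N t = N i`, with `i` even and `t` odd, contains the blossom with
nodes `N i, …, N (t - 1)`. Their union `U` is added to `Ω` (with dual value zero, as `U` was
not in `Ω` before). The matching `M̃` does not change, so the blossom's edges leave `M`. -/
def Shrink [DecidableEq V] (G : SimpleGraph V) (w : Sym2 V → ℝ) (s s' : EdmondsState V) : Prop :=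
  ∃ t N e i, s.IsAltWalk G w t N e ∧ N 0 ∈ s.exposedNodes ∧ Set.InjOn N (Set.Iio t) ∧
    i < t ∧ N t = N i ∧ Even i ∧ Odd t ∧
    s'.Ω = insert ((Finset.Ico i t).biUnion N) s.Ω ∧
    s'.cyc = Function.update s.cyc ((Finset.Ico i t).biUnion N) ((Finset.Ico i t).image e) ∧
    s'.dual = s.dual ∧ s'.matching = s.matching

open Classical in
/-- The dual values after moving by `α` along the rates `d`: values on `𝒯` increase and values
on `𝒮` decrease. -/
noncomputable def shiftedDual (G : SimpleGraph V) (w : Sym2 V → ℝ) (s : EdmondsState V)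
    (d : Finset V → ℝ) (α : ℝ) (U : Finset V) : ℝ :=
  s.dual U + (if U ∈ s.evenNodes G w then α * d U else 0)
    - (if U ∈ s.oddNodes G w then α * d U else 0)

/-- Dual update, performed if `G'` has no `M`-alternating walk of positive length from `X` to `X`.
The dual values on `𝒯` are increased and those on `𝒮` are decreased, at positive rates `d` that
agree at the two ends of an edge of `M`, by the largest amount that respects the dual
constraints. (In the standard version `d = 1`.) Then all sets in `𝒮` with at least three elements
whose value has become zero are deshrunken, which does not change `M̃`: their circuits
contribute the edges of `M̃` inside them to `M`. -/
def DualUpdate (G : SimpleGraph V) (w : Sym2 V → ℝ) (s s' : EdmondsState V) : Prop :=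
  ¬ s.HasExposedWalk G w ∧
  ∃ (d : Finset V → ℝ) (α : ℝ),
    (∀ U ∈ s.oddNodes G w ∪ s.evenNodes G w, 0 < d U) ∧
    (∀ e ∈ s.shrunkMatching, ∀ A B, s.Joins G w e A B → d A = d B) ∧
    IsGreatest {a : ℝ | 0 ≤ a ∧ DualFeasible G w (s.shiftedDual G w d a)} α ∧
    s'.dual = s.shiftedDual G w d α ∧
    (∀ U, U ∈ s'.Ω ↔ U ∈ s.Ω ∧ ¬ (U ∈ s.oddNodes G w ∧ 3 ≤ U.card ∧ s'.dual U = 0)) ∧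
    s'.cyc = s.cyc ∧ s'.matching = s.matching

/-- `s 0, …, s n` are consecutive states of a run of the algorithm. -/
structure IsRun [DecidableEq V] (G : SimpleGraph V) (w : Sym2 V → ℝ)
    (n : ℕ) (s : ℕ → EdmondsState V) : Prop where
  start : (s 0).IsStart G w
  step : ∀ i < n, (s i).Augment G w (s (i + 1)) ∨ (s i).Shrink G w (s (i + 1)) ∨
    (s i).DualUpdate G w (s (i + 1))

/-- The dual values are initially the same for all singletons and zero for all larger sets, and
every dual update increases the dual values of all nodes in `𝒯` by the same amount. -/
structure UniformDuals (G : SimpleGraph V) (w : Sym2 V → ℝ)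
    (n : ℕ) (s : ℕ → EdmondsState V) : Prop where
  start_singleton : ∃ β : ℝ, ∀ v : V, (s 0).dual {v} = β
  start_large : ∀ U : Finset V, 3 ≤ U.card → (s 0).dual U = 0
  update : ∀ i < n, (s i).DualUpdate G w (s (i + 1)) →
    ∃ α : ℝ, ∀ U ∈ (s i).evenNodes G w, (s (i + 1)).dual U = (s i).dual U + α

end EdmondsState

/-!
Write `p v` for the sum of the dual values of all odd sets containing `v` (`potential`). For a
matching `M` of `k` edges, the total dual load `∑ e ∈ M, cutSum π e` equals the sum of `p` over the
covered vertices minus `∑ U, π U * 2|M[U]|` (`IsEdgeMatching.sum_cutSum`). As `2|M[U]| ≤ |U| - 1` for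
odd `U`, and as all matchings of `k` edges leave the same number of vertices exposed, a matching is
cardinality-optimal if its edges are tight, it satisfies `2|M[U]| = |U| - 1` whenever `π U ≠ 0`, and
the vertices it leaves exposed have maximum potential (`cardinalityOptimal_of_tight`).

These conditions are part of an invariant of the algorithm (`EdmondsState.Invariant`). Tightness and
near-perfect matchings inside the members of `Ω` are maintained as in Edmonds' algorithm without any
uniformity. In an augmentation the iterated deshrinking yields, from the nodes of the shrunken graph
downwards, that at most one matching edge leaves each member of `Ω` (`Expanded.cut_unique`) and, from
the singletons upwards, that each member is nearly perfectly matched (`Expanded.nearlyPerfectOn`).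

The potential condition is where uniformity enters. Initially all potentials agree. Once a vertex
is covered it stays covered. Exposed vertices lie in exposed nodes, which belong to `𝒯` and not to
`𝒮`; so a dual update raises their potential by the common change of `𝒯`, which is nonnegative,
and raises no potential by more.
-/

/-! ### Edges, cuts and covered vertices -/

theorem edgeWithin_mk {V : Type*} {u v : V} {U : Finset V} :
    EdgeWithin s(u, v) U ↔ u ∈ U ∧ v ∈ U := by
  simp [EdgeWithin]

theorem edgeCuts_mk {V : Type*} {u v : V} {U : Finset V} :
    EdgeCuts s(u, v) U ↔ (u ∈ U ∧ v ∉ U) ∨ (v ∈ U ∧ u ∉ U) := by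
  simp only [EdgeCuts, Sym2.mem_iff, exists_eq_or_imp, exists_eq_left]
  tauto

theorem edgeCuts_or_edgeWithin {V : Type*} {e : Sym2 V} {v : V} {U : Finset V} (hv : v ∈ e)
    (hU : v ∈ U) : EdgeCuts e U ∨ EdgeWithin e U := by
  induction e with
  | h a b =>
    rw [edgeCuts_mk, edgeWithin_mk]
    rcases Sym2.mem_iff.1 hv with rfl | rfl <;> tauto

theorem EdgeCuts.not_edgeWithin {V : Type*} {e : Sym2 V} {U : Finset V} (h : EdgeCuts e U) :
    ¬ EdgeWithin e U :=
  fun h' ↦ h.2.elim fun v hv ↦ hv.2 (h' v hv.1)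

theorem EdgeWithin.mono {V : Type*} {e : Sym2 V} {A B : Finset V} (h : EdgeWithin e A)
    (hAB : A ⊆ B) : EdgeWithin e B :=
  fun v hv ↦ hAB (h v hv)

theorem EdgeWithin.not_edgeCuts_of_disjoint {V : Type*} {e : Sym2 V} {A B : Finset V}
    (h : EdgeWithin e A) (hAB : Disjoint A B) : ¬ EdgeCuts e B :=
  fun ⟨⟨v, hv, hvB⟩, _⟩ ↦ Finset.disjoint_left.1 hAB (h v hv) hvB

theorem edgeCuts_singleton {V : Type*} {G : SimpleGraph V} {e : Sym2 V} {v : V}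
    (he : e ∈ G.edgeSet) (hv : v ∈ e) : EdgeCuts e {v} := by
  induction e with
  | h a b =>
    have hab : a ≠ b := (G.mem_edgeSet.1 he).ne
    rw [edgeCuts_mk]
    rcases Sym2.mem_iff.1 hv with rfl | rfl
    · simp [hab.symm]
    · simp [hab]

/-- `v` is an end of some edge of `M`. -/
def IsCovered {V : Type*} (M : Finset (Sym2 V)) (v : V) : Prop := ∃ e ∈ M, v ∈ e

/-- All vertices of `U` except possibly one are covered by edges of `M` lying inside `U`. -/
def NearlyPerfectOn {V : Type*} (M : Finset (Sym2 V)) (U : Finset V) : Prop :=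
  ∃ b ∈ U, ∀ v ∈ U, v ≠ b → ∃ e ∈ M, v ∈ e ∧ EdgeWithin e U

/-- The sum of the dual values of all odd sets that contain `v`. -/
noncomputable def potential {V : Type*} [Fintype V] (π : Finset V → ℝ) (v : V) : ℝ :=
  ∑ U ∈ (Finset.univ : Finset (Finset V)) with Odd U.card, by
    classical exact if v ∈ U then π U else 0

section Counting

variable {V : Type*} {G : SimpleGraph V} {M : Finset (Sym2 V)}

open Classical in
theorem card_ends_eq {e : Sym2 V} (he : e ∈ G.edgeSet) (U : Finset V) :
    (U.filter (· ∈ e)).card = (if EdgeCuts e U then 1 else 0) +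
      2 * if EdgeWithin e U then 1 else 0 := by
  induction e with
  | h a b =>
    have hab : a ≠ b := (G.mem_edgeSet.1 he).ne
    have : U.filter (· ∈ s(a, b)) = (({a, b} : Finset V)).filter (· ∈ U) := by
      ext x; simp [and_comm]
    rw [this, edgeCuts_mk, edgeWithin_mk, Finset.filter_insert, Finset.filter_singleton]
    by_cases ha : a ∈ U <;> by_cases hb : b ∈ U <;> simp [ha, hb, hab]

open Classical in
/-- Counting incidences between a matching and a vertex set in two ways. -/
theorem IsEdgeMatching.card_covered (hM : IsEdgeMatching G M) (U : Finset V) :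
    (U.filter (IsCovered M)).card = (M.filter (EdgeCuts · U)).card +
      2 * (M.filter (EdgeWithin · U)).card := by
  have h1 : ∑ e ∈ M, (U.filter (· ∈ e)).card = (U.filter (IsCovered M)).card := by
    simp only [Finset.card_filter]
    rw [Finset.sum_comm]
    refine Finset.sum_congr rfl fun v _ ↦ ?_
    split_ifs with hv
    · obtain ⟨e, he, hve⟩ := hv
      rw [Finset.sum_eq_single_of_mem e he, if_pos hve]
      intro f hf hfe
      rw [if_neg]
      exact fun hvf ↦ hfe (hM.2 f hf e he v hvf hve)
    · refine Finset.sum_eq_zero fun e he ↦ if_neg fun hve ↦ hv ⟨e, he, hve⟩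
  rw [← h1, Finset.sum_congr rfl fun e he ↦ card_ends_eq (hM.1 e he) U, Finset.sum_add_distrib,
    ← Finset.mul_sum, Finset.card_filter, Finset.card_filter]

open Classical in
theorem IsEdgeMatching.card_within_lt (hM : IsEdgeMatching G M) {U : Finset V}
    (hU : Odd U.card) : 2 * (M.filter (EdgeWithin · U)).card + 1 ≤ U.card := by
  have h1 := hM.card_covered U
  have h2 := Finset.card_filter_le U (IsCovered M)
  obtain ⟨k, hk⟩ := hU
  omega

open Classical in
theorem IsEdgeMatching.card_within_eq (hM : IsEdgeMatching G M) {U : Finset V}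
    (hU : Odd U.card) (hn : NearlyPerfectOn M U) :
    2 * (M.filter (EdgeWithin · U)).card + 1 = U.card := by
  refine le_antisymm (hM.card_within_lt hU) ?_
  obtain ⟨b, hb, h⟩ := hn
  have hM' : IsEdgeMatching G (M.filter (EdgeWithin · U)) :=
    ⟨fun e he ↦ hM.1 e (Finset.mem_filter.1 he).1, fun e he f hf ↦
      hM.2 e (Finset.mem_filter.1 he).1 f (Finset.mem_filter.1 hf).1⟩
  have h1 := hM'.card_covered U
  rw [Finset.filter_false_of_mem (p := (EdgeCuts · U)), Finset.filter_filter] at h1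
  · have h2 : (U.erase b).card ≤
        (U.filter (IsCovered (M.filter (EdgeWithin · U)))).card := by
      refine Finset.card_le_card fun v hv ↦ ?_
      obtain ⟨hvb, hvU⟩ := Finset.mem_erase.1 hv
      obtain ⟨e, he, hve, heU⟩ := h v hvU hvb
      exact Finset.mem_filter.2 ⟨hvU, e, Finset.mem_filter.2 ⟨he, heU⟩, hve⟩
    rw [Finset.card_erase_of_mem hb] at h2
    simp only [and_self, Finset.card_empty] at h1
    omega
  · exact fun e he hc ↦ hc.not_edgeWithin (Finset.mem_filter.1 he).2

variable [Fintype V]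

open Classical in
theorem IsEdgeMatching.card_covered_univ (hM : IsEdgeMatching G M) :
    ((Finset.univ : Finset V).filter (IsCovered M)).card = 2 * M.card := by
  rw [hM.card_covered, Finset.filter_true_of_mem (p := (EdgeWithin · Finset.univ)),
    Finset.filter_false_of_mem]
  · simp
  · rintro e _ ⟨_, v, _, hv⟩
    simp at hv
  · exact fun e _ v _ ↦ Finset.mem_univ v

/-! ### Weak duality for matchings of prescribed cardinality -/

open Classical in
theorem potential_eq (π : Finset V → ℝ) (v : V) :
    potential π v =
      ∑ U ∈ (Finset.univ : Finset (Finset V)) with Odd U.card, if v ∈ U then π U else 0 := rfl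

open Classical in
theorem cutSum_eq (π : Finset V → ℝ) (e : Sym2 V) :
    cutSum π e =
      ∑ U ∈ (Finset.univ : Finset (Finset V)) with Odd U.card,
        if EdgeCuts e U then π U else 0 := by
  rw [cutSum, ← Finset.sum_filter, Finset.filter_filter]

open Classical in
/-- The total dual load of a matching, regrouped as a vertex part and a part that counts the
edges inside the odd sets. -/
theorem IsEdgeMatching.sum_cutSum (hM : IsEdgeMatching G M) (π : Finset V → ℝ) :
    ∑ e ∈ M, cutSum π e = ∑ v with IsCovered M v, potential π v -
      ∑ U ∈ (Finset.univ : Finset (Finset V)) with Odd U.card,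
        π U * (2 * (M.filter (EdgeWithin · U)).card) := by
  have h1 : ∑ e ∈ M, cutSum π e = ∑ U ∈ (Finset.univ : Finset (Finset V)) with Odd U.card,
      π U * (M.filter (EdgeCuts · U)).card := by
    simp only [cutSum_eq]
    rw [Finset.sum_comm]
    refine Finset.sum_congr rfl fun U _ ↦ ?_
    rw [← Finset.sum_filter, Finset.sum_const, nsmul_eq_mul, mul_comm]
  have h2 : ∑ v with IsCovered M v, potential π v =
      ∑ U ∈ (Finset.univ : Finset (Finset V)) with Odd U.card,
        π U * (U.filter (IsCovered M)).card := by
    simp only [potential_eq]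
    rw [Finset.sum_comm]
    refine Finset.sum_congr rfl fun U _ ↦ ?_
    rw [← Finset.sum_filter, Finset.sum_const, nsmul_eq_mul, mul_comm, Finset.filter_filter]
    congr 3
    ext v; simp [and_comm]
  rw [h1, h2, ← Finset.sum_sub_distrib]
  refine Finset.sum_congr rfl fun U _ ↦ ?_
  rw [hM.card_covered U]
  push_cast
  ring

/-- Complementary slackness: a matching of tight edges that is nearly perfect on every odd set
with non-zero dual value and leaves only vertices of maximum potential exposed is
cardinality-optimal. -/
theorem cardinalityOptimal_of_tight {w : Sym2 V → ℝ} {π : Finset V → ℝ}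
    (hM : IsEdgeMatching G M) (hπ : DualFeasible G w π)
    (htight : ∀ e ∈ M, cutSum π e = w e)
    (hnear : ∀ U, Odd U.card → π U ≠ 0 → NearlyPerfectOn M U)
    (hmax : ∀ v, ¬ IsCovered M v → ∀ u, potential π u ≤ potential π v) :
    CardinalityOptimal G w M := by
  classical
  refine ⟨hM, fun M' hM' hcard ↦ ?_⟩
  have h1 : ∑ e ∈ M', cutSum π e ≤ ∑ e ∈ M', w e :=
    Finset.sum_le_sum fun e he ↦ hπ.2 e (hM'.1 e he)
  rw [← Finset.sum_congr rfl htight]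
  refine le_trans ?_ h1
  rw [hM.sum_cutSum, hM'.sum_cutSum]
  refine sub_le_sub ?_ (Finset.sum_le_sum fun U hU ↦ ?_)
  · -- Both matchings leave the same number of vertices exposed.
    have hexp : ((Finset.univ : Finset V).filter fun v ↦ ¬ IsCovered M' v).card =
        ((Finset.univ : Finset V).filter fun v ↦ ¬ IsCovered M v).card := by
      have a := Finset.card_filter_add_card_filter_not
        (s := (Finset.univ : Finset V)) (IsCovered M)
      have b := Finset.card_filter_add_card_filter_not
        (s := (Finset.univ : Finset V)) (IsCovered M')
      rw [hM.card_covered_univ] at a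
      rw [hM'.card_covered_univ] at b
      omega
    have hle : ∑ v with ¬ IsCovered M' v, potential π v ≤
        ∑ v with ¬ IsCovered M v, potential π v := by
      rcases Finset.eq_empty_or_nonempty
        ((Finset.univ : Finset V).filter fun v ↦ ¬ IsCovered M v) with h0 | ⟨x, hx⟩
      · rw [h0, Finset.card_empty, Finset.card_eq_zero] at hexp
        rw [h0, hexp]
      · have hx' := (Finset.mem_filter.1 hx).2
        calc _ ≤ _ := Finset.sum_le_card_nsmul _ _ (potential π x) fun u _ ↦ hmax x hx' u
          _ ≤ _ := by
            rw [hexp]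
            exact Finset.card_nsmul_le_sum _ _ _ fun u hu ↦
              hmax u (Finset.mem_filter.1 hu).2 x
    have a := Finset.sum_filter_add_sum_filter_not Finset.univ (IsCovered M) (potential π)
    have b := Finset.sum_filter_add_sum_filter_not Finset.univ (IsCovered M') (potential π)
    linarith
  · have hodd := (Finset.mem_filter.1 hU).2
    have hub := hM'.card_within_lt hodd
    by_cases h0 : π U = 0
    · simp [h0]
    have heq := hM.card_within_eq hodd (hnear U hodd h0)
    rcases Nat.lt_or_ge U.card 3 with h3 | h3
    · -- On a singleton the sign of `π U` is free, but there are no edges inside it.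
      have : U.card = 1 := by
        obtain ⟨k, hk⟩ := hodd
        omega
      have e1 : (M.filter (EdgeWithin · U)).card = 0 := by omega
      have e2 : (M'.filter (EdgeWithin · U)).card = 0 := by omega
      rw [e1, e2]
    · refine mul_le_mul_of_nonneg_left ?_ (hπ.1 U hodd h3)
      have : (M'.filter (EdgeWithin · U)).card ≤ (M.filter (EdgeWithin · U)).card := by omega
      exact_mod_cast Nat.mul_le_mul_left 2 this

end Counting

/-! ### Laminar families of odd sets -/

/-- A laminar family of odd sets that contains all singletons. -/
structure IsOddLaminar {V : Type*} (Ω : Finset (Finset V)) : Prop where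
  singleton_mem : ∀ v, {v} ∈ Ω
  odd : ∀ U ∈ Ω, Odd U.card
  laminar : ∀ A ∈ Ω, ∀ B ∈ Ω, A ⊆ B ∨ B ⊆ A ∨ Disjoint A B

namespace IsOddLaminar

variable {V : Type*} {Ω : Finset (Finset V)} {A B U : Finset V}

theorem mono (h : IsOddLaminar Ω) {Ω' : Finset (Finset V)} (hsub : Ω' ⊆ Ω)
    (hs : ∀ v, {v} ∈ Ω') : IsOddLaminar Ω' :=
  ⟨hs, fun U hU ↦ h.odd U (hsub hU), fun A hA B hB ↦ h.laminar A (hsub hA) B (hsub hB)⟩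

theorem three_le_card (h : IsOddLaminar Ω) (hA : A ∈ Ω) (hU : U ∈ Ω) (hAU : A ⊂ U) :
    3 ≤ U.card := by
  have h1 := (h.odd A hA).pos
  have h2 := Finset.card_lt_card hAU
  obtain ⟨k, hk⟩ := h.odd U hU
  omega

theorem exists_maxSets_superset (hA : A ∈ Ω) : ∃ B ∈ maxSets Ω, A ⊆ B := by
  obtain ⟨B, hAB, hB⟩ := Finset.exists_le_maximal Ω hA
  exact ⟨B, ⟨hB.prop, fun C hC hBC ↦ (hB.eq_of_le hC hBC).symm⟩, hAB⟩

theorem exists_maxSets_mem (h : IsOddLaminar Ω) (v : V) : ∃ B ∈ maxSets Ω, v ∈ B := by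
  obtain ⟨B, hB, hvB⟩ := exists_maxSets_superset (h.singleton_mem v)
  exact ⟨B, hB, Finset.singleton_subset_iff.1 hvB⟩

theorem maxSets_disjoint (h : IsOddLaminar Ω) (hA : A ∈ maxSets Ω) (hB : B ∈ maxSets Ω)
    (hAB : A ≠ B) : Disjoint A B := by
  rcases h.laminar A hA.1 B hB.1 with h1 | h1 | h1
  · exact absurd (hA.2 B hB.1 h1).symm hAB
  · exact absurd (hB.2 A hA.1 h1) hAB
  · exact h1

theorem maxSets_eq_of_mem (h : IsOddLaminar Ω) (hA : A ∈ maxSets Ω) (hB : B ∈ maxSets Ω)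
    {v : V} (hvA : v ∈ A) (hvB : v ∈ B) : A = B :=
  by_contra fun hne ↦ Finset.disjoint_left.1 (h.maxSets_disjoint hA hB hne) hvA hvB

theorem subset_or_disjoint (h : IsOddLaminar Ω) (hA : A ∈ Ω) (hB : B ∈ maxSets Ω) :
    A ⊆ B ∨ Disjoint A B := by
  rcases h.laminar A hA B hB.1 with h1 | h1 | h1
  · exact .inl h1
  · exact .inl (hB.2 A hA h1).subset
  · exact .inr h1

/-- An edge inside a member of the family cuts no node of the shrunken graph. -/
theorem not_edgeCuts_of_edgeWithin (h : IsOddLaminar Ω) (hA : A ∈ Ω) {e : Sym2 V}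
    (he : EdgeWithin e A) (hB : B ∈ maxSets Ω) : ¬ EdgeCuts e B := by
  rcases h.subset_or_disjoint hA hB with h1 | h1
  · exact fun hc ↦ hc.not_edgeWithin (he.mono h1)
  · exact he.not_edgeCuts_of_disjoint h1

theorem exists_childSets_superset (hA : A ∈ Ω) (hAU : A ⊂ U) :
    ∃ B ∈ childSets Ω U, A ⊆ B := by
  classical
  obtain ⟨B, hAB, hB⟩ := Finset.exists_le_maximal (Ω.filter (· ⊂ U))
    (Finset.mem_filter.2 ⟨hA, hAU⟩)
  obtain ⟨hB1, hB2⟩ := Finset.mem_filter.1 hB.prop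
  exact ⟨B, ⟨hB1, hB2, fun C hC hCU hBC ↦
    (hB.eq_of_le (Finset.mem_filter.2 ⟨hC, hCU⟩) hBC).symm⟩, hAB⟩

theorem exists_childSets_mem (h : IsOddLaminar Ω) (hU : 3 ≤ U.card) {v : V} (hv : v ∈ U) :
    ∃ B ∈ childSets Ω U, v ∈ B := by
  have hss : ({v} : Finset V) ⊂ U := by
    refine (Finset.singleton_subset_iff.2 hv).ssubset_of_ne fun he ↦ ?_
    rw [← he, Finset.card_singleton] at hU
    omega
  obtain ⟨B, hB, hvB⟩ := exists_childSets_superset (h.singleton_mem v) hss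
  exact ⟨B, hB, Finset.singleton_subset_iff.1 hvB⟩

theorem childSets_disjoint (h : IsOddLaminar Ω) (hA : A ∈ childSets Ω U)
    (hB : B ∈ childSets Ω U) (hAB : A ≠ B) : Disjoint A B := by
  rcases h.laminar A hA.1 B hB.1 with h1 | h1 | h1
  · exact absurd (hA.2.2 B hB.1 hB.2.1 h1).symm hAB
  · exact absurd (hB.2.2 A hA.1 hA.2.1 h1) hAB
  · exact h1

theorem exists_mem_childSets (hA : A ∈ Ω) (hmax : A ∉ maxSets Ω) :
    ∃ U ∈ Ω, A ∈ childSets Ω U := by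
  classical
  have hex : ∃ B ∈ Ω, A ⊂ B := by
    by_contra! hno
    exact hmax ⟨hA, fun B hB hAB ↦ by_contra fun hne ↦
      hno B hB (hAB.ssubset_of_ne (Ne.symm hne))⟩
  obtain ⟨B, hB, hAB⟩ := hex
  obtain ⟨U, _, hU⟩ := Finset.exists_le_minimal (Ω.filter (A ⊂ ·))
    (Finset.mem_filter.2 ⟨hB, hAB⟩)
  obtain ⟨hU1, hU2⟩ := Finset.mem_filter.1 hU.prop
  refine ⟨U, hU1, hA, hU2, fun C hC hCU hAC ↦ by_contra fun hne ↦ ?_⟩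
  have := hU.eq_of_le (Finset.mem_filter.2 ⟨hC, hAC.ssubset_of_ne (Ne.symm hne)⟩) hCU.subset
  exact hCU.ne this

/-- Downward induction on the family: from the nodes of the shrunken graph to their children,
and so on down to the singletons. -/
theorem induction_down [Finite V] {P : Finset V → Prop}
    (hmax : ∀ A ∈ maxSets Ω, P A)
    (hchild : ∀ U ∈ Ω, P U → ∀ A ∈ childSets Ω U, P A) : ∀ A ∈ Ω, P A := by
  have := Fintype.ofFinite V
  intro A
  induction A using WellFoundedGT.induction with
  | ind A ih =>
    intro hA
    by_cases hm : A ∈ maxSets Ω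
    · exact hmax A hm
    · obtain ⟨U, hU, hAU⟩ := exists_mem_childSets hA hm
      exact hchild U hU (ih U hAU.2.1 hU) A hAU

/-- A family stays laminar when a union of some of its maximal members is added. -/
theorem insert_biUnion [DecidableEq V] (h : IsOddLaminar Ω) {ι : Type*} {I : Finset ι}
    {N : ι → Finset V} (hN : ∀ i ∈ I, N i ∈ maxSets Ω) (hinj : Set.InjOn N I)
    (hI : Odd I.card) : IsOddLaminar (insert (I.biUnion N) Ω) := by
  have hlam : ∀ A ∈ Ω, A ⊆ I.biUnion N ∨ Disjoint A (I.biUnion N) := by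
    intro A hA
    by_cases hex : ∃ i ∈ I, A ⊆ N i
    · obtain ⟨i, hi, hAi⟩ := hex
      exact .inl (hAi.trans (Finset.subset_biUnion_of_mem N hi))
    · push Not at hex
      refine .inr ((Finset.disjoint_biUnion_right _ _ _).2 fun i hi ↦ ?_)
      exact (h.subset_or_disjoint hA (hN i hi)).resolve_left (hex i hi)
  refine ⟨fun v ↦ Finset.mem_insert_of_mem (h.singleton_mem v), ?_, ?_⟩
  · intro U hU
    rcases Finset.mem_insert.1 hU with rfl | hU
    · rw [Finset.card_biUnion fun i hi j hj hij ↦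
        h.maxSets_disjoint (hN i hi) (hN j hj) fun he ↦ hij (hinj hi hj he),
        Finset.odd_sum_iff_odd_card_odd,
        Finset.filter_true_of_mem fun i hi ↦ h.odd _ (hN i hi).1]
      exact hI
    · exact h.odd U hU
  · intro A hA B hB
    rcases Finset.mem_insert.1 hA with rfl | hA <;> rcases Finset.mem_insert.1 hB with rfl | hB
    · exact .inl subset_rfl
    · rcases hlam B hB with h1 | h1
      · exact .inr (.inl h1)
      · exact .inr (.inr h1.symm)
    · rcases hlam A hA with h1 | h1
      · exact .inl h1
      · exact .inr (.inr h1)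
    · exact h.laminar A hA B hB

end IsOddLaminar

/-! ### Change of the dual values at the nodes of the shrunken graph -/

section DualChange

variable {V : Type*} [Fintype V]

theorem cutSum_congr {π π' : Finset V → ℝ} {e : Sym2 V}
    (h : ∀ U, EdgeCuts e U → π' U = π U) : cutSum π' e = cutSum π e := by
  rw [cutSum_eq, cutSum_eq]
  refine Finset.sum_congr rfl fun U _ ↦ ?_
  split_ifs with hc
  · exact h U hc
  · rfl

theorem potential_change {Ω : Finset (Finset V)} (hΩ : IsOddLaminar Ω) {π π' : Finset V → ℝ}
    (h : ∀ U, U ∉ maxSets Ω → π' U = π U) {A : Finset V} (hA : A ∈ maxSets Ω) {v : V}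
    (hv : v ∈ A) : potential π' v = potential π v + (π' A - π A) := by
  rw [← sub_eq_iff_eq_add', potential_eq, potential_eq, ← Finset.sum_sub_distrib,
    Finset.sum_eq_single_of_mem A (by simpa using hΩ.odd A hA.1), if_pos hv, if_pos hv]
  intro U _ hUA
  split_ifs with hvU
  · rw [h U fun hU ↦ hUA (hΩ.maxSets_eq_of_mem hU hA hvU hv), sub_self]
  · rw [sub_self]

theorem cutSum_change {G : SimpleGraph V} {w : Sym2 V → ℝ} {s : EdmondsState V}
    (hΩ : IsOddLaminar s.Ω) {π π' : Finset V → ℝ}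
    (h : ∀ U, U ∉ maxSets s.Ω → π' U = π U) {e : Sym2 V} {A B : Finset V}
    (he : s.Joins G w e A B) :
    cutSum π' e = cutSum π e + ((π' A - π A) + (π' B - π B)) := by
  classical
  obtain ⟨hA, hB, hAB, -, -, u, hu, v, hv, rfl⟩ := he
  have huB : u ∉ B := Finset.disjoint_left.1 (hΩ.maxSets_disjoint hA hB hAB) hu
  have hvA : v ∉ A := Finset.disjoint_right.1 (hΩ.maxSets_disjoint hA hB hAB) hv
  rw [← sub_eq_iff_eq_add', cutSum_eq, cutSum_eq, ← Finset.sum_sub_distrib,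
    Finset.sum_eq_add_of_mem A B (by simpa using hΩ.odd A hA.1) (by simpa using hΩ.odd B hB.1)
      hAB]
  · simp [edgeCuts_mk, hu, hv, huB, hvA]
  · rintro U _ ⟨hUA, hUB⟩
    split_ifs with hc
    · rw [h U, sub_self]
      intro hU
      rcases edgeCuts_mk.1 hc with hc | hc
      · exact hUA (hΩ.maxSets_eq_of_mem hU hA hc.1 hu)
      · exact hUB (hΩ.maxSets_eq_of_mem hU hB hc.1 hv)
    · rw [sub_self]

end DualChange

namespace EdmondsState

variable {V : Type*}

/-! ### Iterated deshrinking -/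

section Expanded

variable {s : EdmondsState V}

theorem mem_shrunkMatching (hΩ : IsOddLaminar s.Ω) {e : Sym2 V} {A : Finset V}
    (he : e ∈ s.matching) (hA : A ∈ maxSets s.Ω) (hc : EdgeCuts e A) : e ∈ s.shrunkMatching :=
  ⟨he, fun _ hB hw ↦ hΩ.not_edgeCuts_of_edgeWithin hB.1 hw hA hc⟩

theorem mem_levelEdges (hΩ : IsOddLaminar s.Ω) {e : Sym2 V} {A U : Finset V}
    (he : e ∈ s.matching) (hA : A ∈ childSets s.Ω U) (hw : EdgeWithin e U)
    (hc : EdgeCuts e A) : e ∈ s.levelEdges U := by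
  refine ⟨he, hw, fun B hB hwB ↦ ?_⟩
  by_cases hBA : B = A
  · exact hc.not_edgeWithin (hBA ▸ hwB)
  · exact hwB.not_edgeCuts_of_disjoint (hΩ.childSets_disjoint hB hA hBA) hc

theorem edgeCuts_or_edgeWithin_of_child {e : Sym2 V} {A U : Finset V}
    (hA : A ∈ childSets s.Ω U) (hc : EdgeCuts e A) : EdgeCuts e U ∨ EdgeWithin e U := by
  obtain ⟨v, hv, hvA⟩ := hc.1
  exact edgeCuts_or_edgeWithin hv (hA.2.1.subset hvA)

/-- In an expanded matching at most one edge leaves each member of `Ω`, as soon as this holds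
for the nodes of the shrunken graph. -/
theorem Expanded.cut_unique [Finite V] (hE : s.Expanded) (hΩ : IsOddLaminar s.Ω)
    (hmax : ∀ A ∈ maxSets s.Ω, ∀ e ∈ s.matching, ∀ f ∈ s.matching,
      EdgeCuts e A → EdgeCuts f A → e = f) :
    ∀ A ∈ s.Ω, ∀ e ∈ s.matching, ∀ f ∈ s.matching, EdgeCuts e A → EdgeCuts f A → e = f := by
  refine IsOddLaminar.induction_down hmax fun U hU ih A hA e he f hf hce hcf ↦ ?_
  obtain ⟨B, hB, hout, hin, hex⟩ := hE U hU (hΩ.three_le_card hA.1 hU hA.2.1)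
  by_cases hAB : A = B
  · subst hAB
    have key : ∀ g ∈ s.matching, EdgeCuts g A → EdgeCuts g U := fun g hg hc ↦
      (edgeCuts_or_edgeWithin_of_child hA hc).resolve_right fun hw ↦
        (hin g (mem_levelEdges hΩ hg hA hw hc)).2 hc
    exact ih e he f hf (key e he hce) (key f hf hcf)
  · have key : ∀ g ∈ s.matching, EdgeCuts g A → g ∈ s.levelEdges U := by
      intro g hg hc
      refine mem_levelEdges hΩ hg hA
        ((edgeCuts_or_edgeWithin_of_child hA hc).resolve_left fun hcU ↦ ?_) hc
      -- An edge cutting `U` has its only end in `U` inside `B`.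
      obtain ⟨v, hv, hvB⟩ := hout g hg hcU
      obtain ⟨u, hu, huA⟩ := hc.1
      have hd := Finset.disjoint_left.1 (hΩ.childSets_disjoint hA hB hAB)
      have huv : u ≠ v := fun h ↦ hd huA (h ▸ hvB)
      have hg' := (Sym2.mem_and_mem_iff huv).1 ⟨hu, hv⟩
      refine hcU.not_edgeWithin ?_
      rw [hg', edgeWithin_mk]
      exact ⟨hA.2.1.subset huA, hB.2.1.subset hvB⟩
    exact (hex A hA hAB).unique ⟨key e he hce, hce⟩ ⟨key f hf hcf, hcf⟩

/-- An expanded matching is nearly perfect on every member of `Ω`. -/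
theorem Expanded.nearlyPerfectOn {G : SimpleGraph V} (hE : s.Expanded) (hΩ : IsOddLaminar s.Ω)
    (hM : IsEdgeMatching G s.matching) : ∀ U ∈ s.Ω, NearlyPerfectOn s.matching U := by
  intro U
  induction U using Finset.strongInduction with
  | H U ih =>
    intro hU
    by_cases h3 : 3 ≤ U.card
    · obtain ⟨B, hB, -, -, hex⟩ := hE U hU h3
      obtain ⟨b, hb, hcov⟩ := ih B hB.2.1 hB.1
      refine ⟨b, hB.2.1.subset hb, fun v hv hvb ↦ ?_⟩
      obtain ⟨A, hA, hvA⟩ := hΩ.exists_childSets_mem h3 hv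
      by_cases hAB : A = B
      · obtain ⟨e, he, hve, hw⟩ := hcov v (hAB ▸ hvA) hvb
        exact ⟨e, he, hve, hw.mono hB.2.1.subset⟩
      · obtain ⟨a, -, hcovA⟩ := ih A hA.2.1 hA.1
        by_cases hva : v = a
        · -- The level edge at `A` must cover the vertex of `A` not covered inside `A`.
          obtain ⟨f, ⟨hf, hfc⟩, -⟩ := hex A hA hAB
          obtain ⟨x, hx, hxA⟩ := hfc.1
          refine ⟨f, hf.1, ?_, hf.2.1⟩
          by_cases hxa : x = a
          · rwa [hva, ← hxa]
          · obtain ⟨e, he, hxe, hw⟩ := hcovA x hxA hxa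
            exact absurd (hM.2 e he f hf.1 x hxe hx ▸ hw) hfc.not_edgeWithin
        · obtain ⟨e, he, hve, hw⟩ := hcovA v hvA hva
          exact ⟨e, he, hve, hw.mono hA.2.1.subset⟩
    · have h1 : U.card = 1 := by
        obtain ⟨k, hk⟩ := hΩ.odd U hU
        omega
      obtain ⟨a, rfl⟩ := Finset.card_eq_one.1 h1
      exact ⟨a, Finset.mem_singleton_self a, fun v hv hva ↦
        absurd (Finset.mem_singleton.1 hv) hva⟩

/-- Every edge of an expanded matching inside a node of the shrunken graph belongs to one of
the shrunken circuits. -/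
theorem Expanded.exists_mem_cyc {G : SimpleGraph V} (hE : s.Expanded) (hΩ : IsOddLaminar s.Ω)
    {e : Sym2 V} (he : e ∈ s.matching) (heG : e ∈ G.edgeSet) {A : Finset V} (hA : A ∈ s.Ω)
    (hw : EdgeWithin e A) : ∃ U ∈ s.Ω, 3 ≤ U.card ∧ e ∈ s.cyc U := by
  classical
  obtain ⟨U, -, hU⟩ := Finset.exists_le_minimal (s.Ω.filter (EdgeWithin e ·))
    (Finset.mem_filter.2 ⟨hA, hw⟩)
  obtain ⟨hU1, hU2⟩ := Finset.mem_filter.1 hU.prop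
  have h3 : 3 ≤ U.card := by
    by_contra h3
    have h1 : U.card = 1 := by
      obtain ⟨k, hk⟩ := hΩ.odd U hU1
      omega
    obtain ⟨a, rfl⟩ := Finset.card_eq_one.1 h1
    induction e with
    | h x y =>
      obtain ⟨hx, hy⟩ := edgeWithin_mk.1 hU2
      rw [Finset.mem_singleton] at hx hy
      exact (G.mem_edgeSet.1 heG).ne (hx.trans hy.symm)
  obtain ⟨B, hB, -, hin, -⟩ := hE U hU1 h3
  refine ⟨U, hU1, h3, (hin e ⟨he, hU2, fun C hC hwC ↦ ?_⟩).1⟩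
  exact hC.2.1.ne (hU.eq_of_le (Finset.mem_filter.2 ⟨hC.1, hwC⟩) hC.2.1.subset)

end Expanded

variable [Fintype V] {G : SimpleGraph V} {w : Sym2 V → ℝ} {s s' : EdmondsState V}

/-! ### Alternating walks -/

section Walks

variable {e : Sym2 V} {A B C : Finset V} {n : ℕ} {N : ℕ → Finset V} {p : ℕ → Sym2 V}

theorem Joins.symm (h : s.Joins G w e A B) : s.Joins G w e B A := by
  obtain ⟨hA, hB, hne, hG, ht, u, hu, v, hv, rfl⟩ := h
  exact ⟨hB, hA, hne.symm, hG, ht, v, hv, u, hu, Sym2.eq_swap⟩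

theorem Joins.cuts_left (h : s.Joins G w e A B) (hΩ : IsOddLaminar s.Ω) : EdgeCuts e A := by
  obtain ⟨hA, hB, hne, -, -, u, hu, v, hv, rfl⟩ := h
  exact edgeCuts_mk.2 (.inl ⟨hu, Finset.disjoint_right.1 (hΩ.maxSets_disjoint hA hB hne) hv⟩)

theorem Joins.cuts_right (h : s.Joins G w e A B) (hΩ : IsOddLaminar s.Ω) : EdgeCuts e B :=
  h.symm.cuts_left hΩ

theorem Joins.eq_or_eq (h : s.Joins G w e A B) (hΩ : IsOddLaminar s.Ω) (hC : C ∈ maxSets s.Ω)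
    (hc : EdgeCuts e C) : C = A ∨ C = B := by
  obtain ⟨hA, hB, -, -, -, u, hu, v, hv, rfl⟩ := h
  rcases edgeCuts_mk.1 hc with hc | hc
  · exact .inl (hΩ.maxSets_eq_of_mem hC hA hc.1 hu)
  · exact .inr (hΩ.maxSets_eq_of_mem hC hB hc.1 hv)

theorem Joins.eq_of_eq_left (h : s.Joins G w e A B) (hΩ : IsOddLaminar s.Ω)
    (h' : s.Joins G w e A C) : B = C :=
  ((h'.eq_or_eq hΩ h.2.1 (h.cuts_right hΩ)).resolve_left h.2.2.1.symm)

theorem IsAltWalk.prefix (h : s.IsAltWalk G w n N p) {m : ℕ} (hm : m ≤ n) :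
    s.IsAltWalk G w m N p :=
  ⟨fun i hi ↦ h.node i (hi.trans hm), fun i hi ↦ h.edge i (hi.trans_le hm),
    fun i hi ↦ h.alt i (hi.trans_le hm)⟩

/-- Along an alternating walk from an exposed node, the matching edges are those in the odd
positions (counted from `0`). -/
theorem IsAltWalk.mem_shrunkMatching_iff (h : s.IsAltWalk G w n N p) (hΩ : IsOddLaminar s.Ω)
    (h0 : N 0 ∈ s.exposedNodes) {i : ℕ} (hi : i < n) :
    p i ∈ s.shrunkMatching ↔ Odd i := by
  induction i with
  | zero =>
    simp only [Nat.not_odd_zero, iff_false]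
    exact fun hp ↦ h0.2 _ hp ((h.edge 0 hi).cuts_left hΩ)
  | succ i ih =>
    have h1 := h.alt i hi
    have h2 := ih (by omega)
    rw [Nat.odd_add_one]
    tauto

/-- Extending an odd alternating walk from an exposed node by a matching edge. -/
theorem IsAltWalk.snoc (h : s.IsAltWalk G w n N p) (hΩ : IsOddLaminar s.Ω)
    (h0 : N 0 ∈ s.exposedNodes) (hn : Odd n) (he : s.Joins G w e (N n) B)
    (heM : e ∈ s.shrunkMatching) :
    s.IsAltWalk G w (n + 1) (Function.update N (n + 1) B) (Function.update p n e) := by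
  have hN : ∀ i ≤ n, Function.update N (n + 1) B i = N i := fun i hi ↦
    Function.update_of_ne (by omega) _ _
  have hp : ∀ i < n, Function.update p n e i = p i := fun i hi ↦
    Function.update_of_ne hi.ne _ _
  refine ⟨fun i hi ↦ ?_, fun i hi ↦ ?_, fun i hi ↦ ?_⟩
  · rcases Nat.lt_or_ge n i with hin | hin
    · obtain rfl : i = n + 1 := by omega
      rw [Function.update_self]
      exact he.2.1
    · rw [hN i hin]
      exact h.node i hin
  · rcases (Nat.lt_succ_iff.1 hi).lt_or_eq with hin | rfl
    · rw [hN i hin.le, hN (i + 1) hin, hp i hin]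
      exact h.edge i hin
    · rw [hN i le_rfl, Function.update_self, Function.update_self]
      exact he
  · rcases (Nat.succ_le_iff.2 (Nat.lt_of_succ_lt_succ hi)).lt_or_eq with hin | hin
    · rw [hp i (by omega), hp (i + 1) hin]
      exact h.alt i hin
    · replace hin : i + 1 = n := hin
      rw [hp i (by omega), hin, Function.update_self, h.mem_shrunkMatching_iff hΩ h0 (by omega),
        ← Nat.not_even_iff_odd]
      have : Even i := by rw [← hin, Nat.odd_add_one, Nat.not_odd_iff_even] at hn; exact hn
      simp [this, heM]

end Walks

/-! ### The invariant -/

/-- The properties of a state that are maintained throughout a run and imply that its matching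
is cardinality-optimal. The last one is where uniform dual changes matter: the exposed vertices
are those whose potential has grown in every dual update. -/
structure Invariant (G : SimpleGraph V) (w : Sym2 V → ℝ) (s : EdmondsState V) : Prop where
  laminar : IsOddLaminar s.Ω
  isMatching : IsEdgeMatching G s.matching
  tight : ∀ e ∈ s.matching, cutSum s.dual e = w e
  nearlyPerfect : ∀ U ∈ s.Ω, NearlyPerfectOn s.matching U
  cyc : ∀ U ∈ s.Ω, ∀ e ∈ s.cyc U, EdgeWithin e U ∧ cutSum s.dual e = w e
  support : ∀ U, U ∉ s.Ω → s.dual U = 0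
  feasible : DualFeasible G w s.dual
  max_potential : ∀ v, ¬ IsCovered s.matching v →
    ∀ u, potential s.dual u ≤ potential s.dual v

namespace Invariant

theorem cardinalityOptimal (h : s.Invariant G w) : CardinalityOptimal G w s.matching :=
  cardinalityOptimal_of_tight h.isMatching h.feasible h.tight
    (fun U _ hU ↦ h.nearlyPerfect U (by_contra fun hΩ ↦ hU (h.support U hΩ)))
    h.max_potential

/-- If a matching edge `e` leaves a member `A` of `Ω`, then its end in `A` is the one vertex that is
not covered inside `A`. -/
theorem covered_of_cut (h : s.Invariant G w) {A : Finset V} (hA : A ∈ s.Ω) {e : Sym2 V}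
    (he : e ∈ s.matching) (hc : EdgeCuts e A) {v : V} (hv : v ∈ A) :
    v ∈ e ∨ ∃ f ∈ s.matching, v ∈ f ∧ EdgeWithin f A := by
  obtain ⟨b, hb, hcov⟩ := h.nearlyPerfect A hA
  obtain ⟨x, hx, hxA⟩ := hc.1
  by_cases hvb : v = b
  · by_cases hxb : x = b
    · exact .inl (by rwa [hvb, ← hxb])
    · obtain ⟨f, hf, hxf, hw⟩ := hcov x hxA hxb
      exact absurd (h.isMatching.2 f hf e he x hxf hx ▸ hw) hc.not_edgeWithin
  · exact .inr (hcov v hv hvb)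

theorem isCovered_of_cut (h : s.Invariant G w) {A : Finset V} (hA : A ∈ s.Ω) {e : Sym2 V}
    (he : e ∈ s.matching) (hc : EdgeCuts e A) {v : V} (hv : v ∈ A) :
    IsCovered s.matching v := by
  rcases h.covered_of_cut hA he hc hv with h1 | ⟨f, hf, hvf, -⟩
  · exact ⟨e, he, h1⟩
  · exact ⟨f, hf, hvf⟩

theorem cut_unique (h : s.Invariant G w) {A : Finset V} (hA : A ∈ s.Ω) {e f : Sym2 V}
    (he : e ∈ s.matching) (hf : f ∈ s.matching) (hce : EdgeCuts e A) (hcf : EdgeCuts f A) :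
    e = f := by
  obtain ⟨x, hx, hxA⟩ := hcf.1
  rcases h.covered_of_cut hA he hce hxA with h1 | ⟨g, hg, hxg, hw⟩
  · exact h.isMatching.2 e he f hf x h1 hx
  · exact absurd (h.isMatching.2 g hg f hf x hxg hx ▸ hw) hcf.not_edgeWithin

theorem of_isStart (h : s.IsStart G w) (hβ : ∃ β : ℝ, ∀ v : V, s.dual {v} = β) :
    s.Invariant G w where
  laminar := by
    refine ⟨fun v ↦ (h.omega _).2 ⟨v, rfl⟩, fun U hU ↦ ?_, fun A hA B hB ↦ ?_⟩
    · obtain ⟨v, rfl⟩ := (h.omega U).1 hU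
      simp
    · obtain ⟨u, rfl⟩ := (h.omega A).1 hA
      obtain ⟨v, rfl⟩ := (h.omega B).1 hB
      by_cases huv : u = v
      · exact .inl (by rw [huv])
      · exact .inr (.inr (Finset.disjoint_singleton.2 huv))
  isMatching := by simp [IsEdgeMatching, h.matching]
  tight := by simp [h.matching]
  nearlyPerfect U hU := by
    obtain ⟨v, rfl⟩ := (h.omega U).1 hU
    exact ⟨v, by simp, by simp⟩
  cyc := by simp [h.cyc]
  support := h.support
  feasible := h.feasible
  max_potential v _ u := by
    obtain ⟨β, hβ⟩ := hβ
    have key : ∀ x, potential s.dual x = β := by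
      intro x
      rw [potential_eq, Finset.sum_eq_single_of_mem {x} (by simp), if_pos (by simp), hβ]
      intro U _ hU
      split_ifs with hx
      · refine h.support U fun hUΩ ↦ ?_
        obtain ⟨y, rfl⟩ := (h.omega U).1 hUΩ
        exact hU (by rw [Finset.mem_singleton.1 hx])
      · rfl
    rw [key, key]

/-! ### Augmentation -/

/-- After the symmetric difference with an augmenting path, at most one matching edge leaves
each node of the shrunken graph, and each node of the path is left by one. -/
theorem augment_cut (h : s.Invariant G w) {n : ℕ} {N : ℕ → Finset V} {p : ℕ → Sym2 V}
    (hW : s.IsAltWalk G w n N p) (hn : 0 < n) (hinj : Set.InjOn N (Set.Iic n))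
    (h0 : N 0 ∈ s.exposedNodes) (hlast : N n ∈ s.exposedNodes) :
    (∀ A ∈ maxSets s.Ω, ∀ e ∈ symmDiff s.shrunkMatching (p '' Set.Iio n),
      ∀ f ∈ symmDiff s.shrunkMatching (p '' Set.Iio n), EdgeCuts e A → EdgeCuts f A → e = f) ∧
    ∀ i ≤ n, ∃ e ∈ symmDiff s.shrunkMatching (p '' Set.Iio n), EdgeCuts e (N i) := by
  have hΩ := h.laminar
  have hodd : ∀ i < n, (p i ∈ s.shrunkMatching ↔ Odd i) := fun i hi ↦
    hW.mem_shrunkMatching_iff hΩ h0 hi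
  have hnodd : Odd n := by
    obtain ⟨m, rfl⟩ := Nat.exists_eq_succ_of_ne_zero hn.ne'
    rw [Nat.succ_eq_add_one, Nat.odd_add_one, ← hodd m (by omega)]
    exact fun hm ↦ hlast.2 _ hm ((hW.edge m (by omega)).cuts_right hΩ)
  -- The edges of the path at its `i`-th node.
  have hcut : ∀ i ≤ n, ∀ j < n, EdgeCuts (p j) (N i) → i = j ∨ i = j + 1 := by
    intro i hi j hj hc
    rcases (hW.edge j hj).eq_or_eq hΩ (hW.node i hi) hc with h1 | h1
    · exact .inl (hinj hi (Set.mem_Iic.2 hj.le) h1)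
    · exact .inr (hinj hi (Set.mem_Iic.2 hj) h1)
  -- A matching edge at a node of the path lies on the path.
  have hMP : ∀ i ≤ n, ∀ e ∈ s.shrunkMatching, EdgeCuts e (N i) → e ∈ p '' Set.Iio n := by
    intro i hi e he hc
    have hi0 : i ≠ 0 := by
      rintro rfl
      exact h0.2 e he hc
    have hin : i ≠ n := by
      rintro rfl
      exact hlast.2 e he hc
    have hmem : ∀ j < n, Odd j → EdgeCuts (p j) (N i) → e ∈ p '' Set.Iio n := fun j hj hjo hcj ↦
      ⟨j, hj, h.cut_unique (hW.node i hi).1 ((hodd j hj).2 hjo).1 he.1 hcj hc⟩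
    obtain ⟨k, rfl⟩ := Nat.exists_eq_succ_of_ne_zero hi0
    rcases Nat.even_or_odd k with hk | hk
    · exact hmem (k + 1) (by omega) hk.add_one ((hW.edge (k + 1) (by omega)).cuts_left hΩ)
    · exact hmem k (by omega) hk ((hW.edge k (by omega)).cuts_right hΩ)
  have hPnew : ∀ j < n, Even j → p j ∈ symmDiff s.shrunkMatching (p '' Set.Iio n) := fun j hj hje ↦
    .inr ⟨⟨j, hj, rfl⟩, fun hm ↦ Nat.not_odd_iff_even.2 hje ((hodd j hj).1 hm)⟩
  constructor
  · intro A hA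
    by_cases hex : ∃ i ≤ n, N i = A
    · obtain ⟨i, hi, rfl⟩ := hex
      -- Every new matching edge at `N i` is the path edge there in even position.
      have key : ∀ e ∈ symmDiff s.shrunkMatching (p '' Set.Iio n), EdgeCuts e (N i) →
          ∃ j < n, Even j ∧ (i = j ∨ i = j + 1) ∧ e = p j := by
        rintro e (⟨he, hnot⟩ | ⟨⟨j, hj, rfl⟩, hnot⟩) hc
        · exact absurd (hMP i hi e he hc) hnot
        · exact ⟨j, hj, Nat.not_odd_iff_even.1 fun ho ↦ hnot ((hodd j hj).2 ho),
            hcut i hi j hj hc, rfl⟩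
      intro e he f hf hce hcf
      obtain ⟨j, -, ⟨a, ha⟩, hj, rfl⟩ := key e he hce
      obtain ⟨k, -, ⟨b, hb⟩, hk, rfl⟩ := key f hf hcf
      congr 1
      omega
    · have key : ∀ e ∈ symmDiff s.shrunkMatching (p '' Set.Iio n), EdgeCuts e A →
          e ∈ s.matching := by
        rintro e (⟨he, -⟩ | ⟨⟨j, hj, rfl⟩, -⟩) hc
        · exact he.1
        · exfalso
          rcases (hW.edge j hj).eq_or_eq hΩ hA hc with h1 | h1
          · exact hex ⟨j, le_of_lt hj, h1.symm⟩
          · exact hex ⟨j + 1, hj, h1.symm⟩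
      exact fun e he f hf hce hcf ↦ h.cut_unique hA.1 (key e he hce) (key f hf hcf) hce hcf
  · intro i hi
    rcases Nat.even_or_odd i with hie | hio
    · have hlt : i < n := by
        refine hi.lt_of_ne ?_
        rintro rfl
        exact Nat.not_odd_iff_even.2 hie hnodd
      exact ⟨p i, hPnew i hlt hie, (hW.edge i hlt).cuts_left hΩ⟩
    · obtain ⟨k, rfl⟩ := Nat.exists_eq_succ_of_ne_zero hio.pos.ne'
      exact ⟨p k, hPnew k (by omega) (by rwa [Nat.succ_eq_add_one, Nat.odd_add_one,
        Nat.not_odd_iff_even] at hio), (hW.edge k (by omega)).cuts_right hΩ⟩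

theorem augment (h : s.Invariant G w) (hs : s.Augment G w s') : s'.Invariant G w := by
  obtain ⟨n, N, p, hW, hn, hinj, h0, hlast, hΩeq, hcyc, hdual, hsymm, hG, hE, hsame⟩ := hs
  have hΩ := h.laminar
  have hΩ' : IsOddLaminar s'.Ω := hΩeq ▸ hΩ
  obtain ⟨huniq, hpath⟩ := h.augment_cut hW hn hinj h0 hlast
  rw [← hsymm, ← hΩeq] at huniq
  rw [← hsymm] at hpath
  have hcut := hE.cut_unique hΩ' fun A hA e he f hf hce hcf ↦
    huniq A hA e (mem_shrunkMatching hΩ' he hA hce) f (mem_shrunkMatching hΩ' hf hA hcf) hce hcf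
  have hM : IsEdgeMatching G s'.matching := ⟨hG, fun e he f hf v hve hvf ↦
    hcut {v} (hΩ'.singleton_mem v) e he f hf (edgeCuts_singleton (hG e he) hve)
      (edgeCuts_singleton (hG f hf) hvf)⟩
  have hcycle : ∀ U ∈ s'.Ω, ∀ e ∈ s'.cyc U, EdgeWithin e U ∧ cutSum s'.dual e = w e := by
    rw [hΩeq, hcyc, hdual]
    exact h.cyc
  have hinv : (∀ v, ¬ IsCovered s'.matching v →
      ∀ u, potential s'.dual u ≤ potential s'.dual v) → s'.Invariant G w := fun hmax ↦ {
    laminar := hΩ'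
    isMatching := hM
    tight := by
      intro e he
      by_cases hex : ∃ A ∈ maxSets s'.Ω, EdgeWithin e A
      · obtain ⟨A, hA, hw⟩ := hex
        obtain ⟨U, hU, -, heU⟩ := hE.exists_mem_cyc hΩ' he (hG e he) hA.1 hw
        exact (hcycle U hU e heU).2
      · push Not at hex
        have hsh : e ∈ s'.shrunkMatching := ⟨he, hex⟩
        rw [hsymm] at hsh
        rw [hdual]
        rcases hsh with ⟨he', -⟩ | ⟨⟨j, hj, rfl⟩, -⟩
        · exact h.tight e he'.1
        · exact (hW.edge j hj).2.2.2.2.1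
    nearlyPerfect := hE.nearlyPerfectOn hΩ' hM
    cyc := hcycle
    support := by
      rw [hΩeq, hdual]
      exact h.support
    feasible := hdual ▸ h.feasible
    max_potential := hmax }
  refine hinv fun v hv ↦ ?_
  rw [hdual]
  -- An exposed vertex was already exposed before the augmentation.
  refine h.max_potential v fun hcov ↦ hv ?_
  obtain ⟨A, hA, hvA⟩ := hΩ.exists_maxSets_mem v
  by_cases hex : ∃ i ≤ n, N i = A
  · obtain ⟨i, hi, rfl⟩ := hex
    obtain ⟨e, he, hc⟩ := hpath i hi
    obtain ⟨x, hx, hxA⟩ := hc.1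
    obtain ⟨b, -, hb⟩ := hE.nearlyPerfectOn hΩ' hM (N i) (hΩeq ▸ hA.1)
    by_cases hvb : v = b
    · by_cases hxb : x = b
      · exact ⟨e, he.1, by rwa [hvb, ← hxb]⟩
      · obtain ⟨f, hf, hxf, hw⟩ := hb x hxA hxb
        exact absurd (hM.2 f hf e he.1 x hxf hx ▸ hw) hc.not_edgeWithin
    · obtain ⟨f, hf, hvf, -⟩ := hb v hvA hvb
      exact ⟨f, hf, hvf⟩
  · push Not at hex
    obtain ⟨e, he, hve⟩ := hcov
    rcases edgeCuts_or_edgeWithin hve hvA with hc | hw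
    · have hsh : e ∈ s'.shrunkMatching := by
        rw [hsymm]
        refine .inl ⟨mem_shrunkMatching hΩ he hA hc, ?_⟩
        rintro ⟨j, hj, rfl⟩
        rcases (hW.edge j hj).eq_or_eq hΩ hA hc with h1 | h1
        · exact hex j (le_of_lt hj) h1.symm
        · exact hex (j + 1) hj h1.symm
      exact ⟨e, hsh.1, hve⟩
    · exact ⟨e, (hsame A hA hex e hw).2 he, hve⟩

/-! ### Shrinking -/

theorem shrink [DecidableEq V] (h : s.Invariant G w) (hs : s.Shrink G w s') :
    s'.Invariant G w := by
  obtain ⟨t, N, p, i, hW, h0, hinj, hit, hclose, hi, ht, hΩeq, hcyc, hdual, hM⟩ := hs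
  have hΩ := h.laminar
  have hN : ∀ j ∈ Finset.Ico i t, N j ∈ maxSets s.Ω := fun j hj ↦
    hW.node j (Finset.mem_Ico.1 hj).2.le
  have hinj' : Set.InjOn N (Finset.Ico i t) := hinj.mono fun j hj ↦
    (Finset.mem_Ico.1 (Finset.mem_coe.1 hj)).2
  have hlam : IsOddLaminar (insert ((Finset.Ico i t).biUnion N) s.Ω) := by
    refine hΩ.insert_biUnion hN hinj' ?_
    rw [Nat.card_Ico]
    exact Nat.Odd.sub_even hit.le ht hi
  set U := (Finset.Ico i t).biUnion N with hUdef
  have hsub : ∀ j, i ≤ j → j ≤ t → N j ⊆ U := by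
    intro j hij hjt
    rcases hjt.lt_or_eq with hlt | rfl
    · exact Finset.subset_biUnion_of_mem N (Finset.mem_Ico.2 ⟨hij, hlt⟩)
    · rw [hclose]
      exact Finset.subset_biUnion_of_mem N (Finset.mem_Ico.2 ⟨le_rfl, hit⟩)
  have hwithin : ∀ j, i ≤ j → j < t → EdgeWithin (p j) U := by
    intro j hij hjt
    obtain ⟨-, -, -, -, -, u, hu, v, hv, hp⟩ := hW.edge j hjt
    rw [hp, edgeWithin_mk]
    exact ⟨hsub j hij hjt.le hu, hsub (j + 1) (by omega) hjt hv⟩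
  have hcov : NearlyPerfectOn s.matching U := by
    obtain ⟨b, hb, hcovb⟩ := h.nearlyPerfect (N i) (hW.node i hit.le).1
    refine ⟨b, hsub i le_rfl hit.le hb, fun v hv hvb ↦ ?_⟩
    obtain ⟨j, hj, hvj⟩ := Finset.mem_biUnion.1 hv
    obtain ⟨hij, hjt⟩ := Finset.mem_Ico.1 hj
    rcases hij.eq_or_lt with rfl | hij'
    · obtain ⟨e, he, hve, hw⟩ := hcovb v hvj hvb
      exact ⟨e, he, hve, hw.mono (hsub _ le_rfl hjt.le)⟩
    · -- The matching edge of the circuit at `N j` covers the rest of `N j`.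
      have hedge : ∃ k, i ≤ k ∧ k < t ∧ Odd k ∧ EdgeCuts (p k) (N j) := by
        rcases Nat.even_or_odd j with hje | hjo
        · obtain ⟨k, rfl⟩ := Nat.exists_eq_succ_of_ne_zero (Nat.ne_zero_of_lt hij')
          refine ⟨k, by omega, by omega, ?_, (hW.edge k (by omega)).cuts_right hΩ⟩
          rwa [Nat.succ_eq_add_one, Nat.even_add_one, Nat.not_even_iff_odd] at hje
        · exact ⟨j, hij, hjt, hjo, (hW.edge j hjt).cuts_left hΩ⟩
      obtain ⟨k, hik, hkt, hko, hc⟩ := hedge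
      have hk := ((hW.mem_shrunkMatching_iff hΩ h0 hkt).2 hko).1
      rcases h.covered_of_cut (hN j hj).1 hk hc hvj with h1 | ⟨f, hf, hvf, hw⟩
      · exact ⟨p k, hk, h1, hwithin k hik hkt⟩
      · exact ⟨f, hf, hvf, hw.mono (hsub j hij hjt.le)⟩
  exact {
    laminar := hΩeq ▸ hlam
    isMatching := hM ▸ h.isMatching
    tight := by
      rw [hM, hdual]
      exact h.tight
    nearlyPerfect := by
      intro A hA
      rw [hM]
      rw [hΩeq] at hA
      rcases Finset.mem_insert.1 hA with rfl | hA
      · exact hcov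
      · exact h.nearlyPerfect A hA
    cyc := by
      intro A hA e he
      rw [hcyc] at he
      rw [hdual]
      by_cases hAU : A = U
      · subst hAU
        rw [Function.update_self] at he
        obtain ⟨j, hj, rfl⟩ := Finset.mem_image.1 he
        obtain ⟨hij, hjt⟩ := Finset.mem_Ico.1 hj
        exact ⟨hwithin j hij hjt, (hW.edge j hjt).2.2.2.2.1⟩
      · rw [Function.update_of_ne hAU] at he
        rw [hΩeq] at hA
        exact h.cyc A ((Finset.mem_insert.1 hA).resolve_left hAU) e he
    support := by
      intro A hA
      rw [hΩeq] at hA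
      rw [hdual]
      exact h.support A fun hA' ↦ hA (Finset.mem_insert_of_mem hA')
    feasible := hdual ▸ h.feasible
    max_potential := by
      rw [hM, hdual]
      exact h.max_potential }

/-! ### Dual updates -/

theorem mem_maxSets_of_mem_oddNodes {A : Finset V} (hA : A ∈ s.oddNodes G w) : A ∈ maxSets s.Ω := by
  obtain ⟨n, N, p, hW, -, -, rfl⟩ := hA
  exact hW.node n le_rfl

theorem mem_maxSets_of_mem_evenNodes {A : Finset V} (hA : A ∈ s.evenNodes G w) : A ∈ maxSets s.Ω := by
  obtain ⟨n, N, p, hW, -, -, rfl⟩ := hA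
  exact hW.node n le_rfl

theorem mem_evenNodes_of_mem_exposedNodes {A : Finset V} (v : V)
    (hA : A ∈ s.exposedNodes) : A ∈ s.evenNodes G w :=
  -- The walk of length zero; its edge function is irrelevant.
  ⟨0, fun _ ↦ A, fun _ ↦ s(v, v), ⟨fun _ _ ↦ hA.1, by simp, by simp⟩, Even.zero, hA, rfl⟩

/-- A matching edge joins nodes of opposite parity. -/
theorem mem_oddNodes_iff (h : s.Invariant G w) {e : Sym2 V} {A B : Finset V}
    (he : e ∈ s.shrunkMatching) (hj : s.Joins G w e A B) :
    A ∈ s.oddNodes G w ↔ B ∈ s.evenNodes G w := by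
  have hΩ := h.laminar
  constructor
  · rintro ⟨n, N, p, hW, hn, h0, rfl⟩
    refine ⟨n + 1, _, _, hW.snoc hΩ h0 hn hj he, hn.add_one, ?_, Function.update_self _ _ _⟩
    rwa [Function.update_of_ne (by omega)]
  · rintro ⟨n, N, p, hW, hn, h0, rfl⟩
    rcases Nat.eq_zero_or_pos n with rfl | hpos
    · exact absurd (hj.cuts_right hΩ) (h0.2 e he)
    obtain ⟨k, rfl⟩ := Nat.exists_eq_succ_of_ne_zero hpos.ne'
    have hk : Odd k := by
      rwa [Nat.succ_eq_add_one, Nat.even_add_one, Nat.not_even_iff_odd] at hn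
    have hjk := hW.edge k (Nat.lt_succ_self k)
    have hp := ((hW.mem_shrunkMatching_iff hΩ h0 (Nat.lt_succ_self k)).2 hk).1
    have hpe : p k = e := h.cut_unique (hW.node _ le_rfl).1 hp he.1 (hjk.cuts_right hΩ)
      (hj.cuts_right hΩ)
    rw [hpe] at hjk
    exact ⟨k, N, p, hW.prefix (Nat.le_succ k), hk, h0, hjk.symm.eq_of_eq_left hΩ hj.symm⟩

theorem exists_joins (h : s.Invariant G w) {e : Sym2 V} (he : e ∈ s.shrunkMatching) :
    ∃ A B, s.Joins G w e A B := by
  have htight := h.tight e he.1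
  have hG := h.isMatching.1 e he.1
  induction e with
  | h u v =>
    obtain ⟨A, hA, hu⟩ := h.laminar.exists_maxSets_mem u
    obtain ⟨B, hB, hv⟩ := h.laminar.exists_maxSets_mem v
    refine ⟨A, B, hA, hB, ?_, hG, htight, u, hu, v, hv, rfl⟩
    rintro rfl
    exact he.2 A hA (edgeWithin_mk.2 ⟨hu, hv⟩)

theorem mem_exposedNodes (h : s.Invariant G w) {v : V} (hv : ¬ IsCovered s.matching v)
    {A : Finset V} (hA : A ∈ maxSets s.Ω) (hvA : v ∈ A) : A ∈ s.exposedNodes :=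
  ⟨hA, fun _ he hc ↦ hv (h.isCovered_of_cut hA.1 he.1 hc hvA)⟩

theorem dualUpdate (h : s.Invariant G w) (hs : s.DualUpdate G w s')
    (hunif : ∃ α : ℝ, ∀ U ∈ s.evenNodes G w, s'.dual U = s.dual U + α) :
    s'.Invariant G w := by
  obtain ⟨hno, d, α, hd, hdM, hα, hdual, hΩeq, hcyc, hM⟩ := hs
  obtain ⟨⟨hα0, hfeas⟩, -⟩ := hα
  obtain ⟨γ, hγ⟩ := hunif
  have hΩ := h.laminar
  have hΔ : ∀ U, s'.dual U = s.shiftedDual G w d α U := fun U ↦ congrFun hdual U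
  simp only [shiftedDual] at hΔ
  have hoff : ∀ U, U ∉ maxSets s.Ω → s'.dual U = s.dual U := by
    intro U hU
    rw [hΔ, if_neg fun hc ↦ hU (mem_maxSets_of_mem_evenNodes hc), if_neg fun hc ↦ hU (mem_maxSets_of_mem_oddNodes hc)]
    ring
  have hsub : s'.Ω ⊆ s.Ω := fun U hU ↦ ((hΩeq U).1 hU).1
  have hinside : ∀ e A, A ∈ s.Ω → EdgeWithin e A → cutSum s'.dual e = cutSum s.dual e :=
    fun e A hA hw ↦ cutSum_congr fun U hc ↦ hoff U fun hU ↦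
      hΩ.not_edgeCuts_of_edgeWithin hA hw hU hc
  exact {
    laminar := hΩ.mono hsub fun v ↦ (hΩeq _).2 ⟨hΩ.singleton_mem v, fun hc ↦ by simp at hc⟩
    isMatching := hM ▸ h.isMatching
    tight := by
      intro e he
      rw [hM] at he
      rw [← h.tight e he]
      by_cases hex : ∃ A ∈ maxSets s.Ω, EdgeWithin e A
      · obtain ⟨A, hA, hw⟩ := hex
        exact hinside e A hA.1 hw
      · push Not at hex
        have hsh : e ∈ s.shrunkMatching := ⟨he, hex⟩
        obtain ⟨A, B, hj⟩ := h.exists_joins hsh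
        -- The changes at the two ends of a matching edge cancel.
        have h1 := h.mem_oddNodes_iff hsh hj
        have h2 := h.mem_oddNodes_iff hsh hj.symm
        rw [cutSum_change hΩ hoff hj, hΔ A, hΔ B, hdM e hsh A B hj]
        by_cases hA : A ∈ s.evenNodes G w <;> by_cases hB : B ∈ s.evenNodes G w <;>
          simp [h1, h2, hA, hB]
    nearlyPerfect := fun U hU ↦ hM ▸ h.nearlyPerfect U (hsub hU)
    cyc := by
      intro U hU e he
      rw [hcyc] at he
      obtain ⟨hw, ht⟩ := h.cyc U (hsub hU) e he
      exact ⟨hw, (hinside e U (hsub hU) hw).trans ht⟩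
    support := by
      intro U hU
      by_cases hUΩ : U ∈ s.Ω
      · by_contra hne
        exact hU ((hΩeq U).2 ⟨hUΩ, fun hc ↦ hne hc.2.2⟩)
      · rw [hoff U fun hc ↦ hUΩ hc.1, h.support U hUΩ]
    feasible := hdual ▸ hfeas
    max_potential := by
      intro v hv u
      rw [hM] at hv
      obtain ⟨A, hA, hvA⟩ := hΩ.exists_maxSets_mem v
      obtain ⟨B, hB, huB⟩ := hΩ.exists_maxSets_mem u
      have hX := h.mem_exposedNodes hv hA hvA
      have hT : A ∈ s.evenNodes G w := mem_evenNodes_of_mem_exposedNodes v hX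
      have hS : A ∉ s.oddNodes G w := by
        rintro ⟨n, N, p, hW, hn, h0, rfl⟩
        exact hno ⟨n, N, p, hW, hn.pos, h0, hX⟩
      -- The common change on `𝒯` is nonnegative, since it is the change at an exposed node.
      have hγ0 : 0 ≤ γ := by
        have h1 := hγ A hT
        rw [hΔ, if_pos hT, if_neg hS] at h1
        have h2 := mul_nonneg hα0 (hd A (.inr hT)).le
        linarith
      have hBγ : s'.dual B - s.dual B ≤ γ := by
        by_cases hBT : B ∈ s.evenNodes G w
        · rw [hγ B hBT]
          linarith
        · rw [hΔ, if_neg hBT]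
          split_ifs with hBS
          · have h2 := mul_nonneg hα0 (hd B (.inl hBS)).le
            linarith
          · linarith
      rw [potential_change hΩ hoff hA hvA, potential_change hΩ hoff hB huB, hγ A hT]
      have := h.max_potential v hv u
      linarith }

end Invariant

end EdmondsState

/-! ### Optimality throughout a run -/

theorem mainTheorem1 {V : Type*} [Fintype V] [DecidableEq V] (G : SimpleGraph V)
    (w : Sym2 V → ℝ) (n : ℕ) (s : ℕ → EdmondsState V)
    (hrun : EdmondsState.IsRun G w n s) (hunif : EdmondsState.UniformDuals G w n s) :
    ∀ i ≤ n, CardinalityOptimal G w (s i).matching := by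
  suffices hinv : ∀ i ≤ n, (s i).Invariant G w from fun i hi ↦ (hinv i hi).cardinalityOptimal
  intro i
  induction i with
  | zero => exact fun _ ↦ .of_isStart hrun.start hunif.start_singleton
  | succ i ih =>
    intro hi
    rcases hrun.step i hi with h | h | h
    · exact (ih (by omega)).augment h
    · exact (ih (by omega)).shrink h
    · exact (ih (by omega)).dualUpdate h (hunif.update i hi h)
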